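/- Let $\mathcal{E}$ be an elementary topos (finite limits, exponentials, a subobject classifier $\Omega$) which has all countable colimits, with chosen finite products, exponentials and subobject classifier. Interpret the internal (Mitchell–Bénabou) language of $\mathcal{E}$ as usual: a term $t:B$ in a context $x:A$ is a morphism $\llbracket x:A.\,t\rrbracket : A\to B$, a formula $p$ in the context $x:A$ is a subobject $\llbracket x:A.\,p\rrbracket\rightarrowtail A$, and the power type $\mathcal{P}A$ is $\Omega^A$. Write $\{a\}=\{a':A\mid a'=a\}$, $\varnothing_A=\{a:A\mid\bot\}$, $Z_1\cup_U Z_2=\{u:U\mid u\in Z_1\vee u\in Z_2\}$ and, for a morphism $f:A\to B$, $f(Z)=\{b:B\mid\exists a:A,\ a\in Z\wedge b=fa\}$. For objects $A,B$ of $\mathcal{E}$ let $$(A\textstyle\coprod B)(z):=\big(\exists a:A,\ z=\langle\{a\},\varnothing_B\rangle\big)\vee\big(\exists b:B,\ z=\langle\varnothing_A,\{b\}\rangle\big),\qquad z:\mathcal{P}A\times\mathcal{P}B,$$ and let $Q=\llbracket z:\mathcal{P}A\times\mathcal{P}B.\,(A\coprod B)(z)\rrbracket\overset{j}{\rightarrowtail}\Omega^A\times\Omega^B$.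 Then: 1. The composites $A\xrightarrow{\llbracket a.\{a\}\rrbracket}\Omega^A\xrightarrow{\llbracket z.\langle z,\varnothing_B\rangle\rrbracket}\Omega^A\times\Omega^B$ and $B\xrightarrow{\llbracket b.\{b\}\rrbracket}\Omega^B\xrightarrow{\llbracket z.\langle\varnothing_A,z\rangle\rrbracket}\Omega^A\times\Omega^B$ factor through $j$, by (necessarily unique) morphisms $\iota_A:A\to Q$ and $\iota_B:B\to Q$. 2. $(Q,\iota_A,\iota_B)$ is a coproduct of $A$ and $B$ in $\mathcal{E}$. 3. For every object $U$ and all morphisms $g_0:A\to U$, $g_1:B\to U$, put $T=\llbracket z:\mathcal{P}U.\,\exists u:U,\ z=\{u\}\rrbracket\overset{k}{\rightarrowtail}\Omega^U$. There is an isomorphism $e:U\to T$ with $k e=\llbracket u.\{u\}\rrbracket$, and there is a morphism $m:Q\to T$ with $$k\,m=\llbracket u:\mathcal{P}U\times\mathcal{P}U.\ \operatorname{fst}u\cup_U\operatorname{snd}u\rrbracket\circ\llbracket z:\mathcal{P}A\times\mathcal{P}B.\ \langle g_0(\operatorname{fst}z),g_1(\operatorname{snd}z)\rangle\rrbracket\circ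 j,$$ and the mediating morphism of the coproduct is $e^{-1}m$: one has $e^{-1}m\,\iota_A=g_0$ and $e^{-1}m\,\iota_B=g_1$. -/

import Mathlib

open CategoryTheory CategoryTheory.Limits MonoidalCategory CartesianMonoidalCategory

universe v u

namespace InternalLogic

noncomputable section

/-! ### The algebra of subobjects of an object of a topos

Throughout, a topos with countable colimits is a category `C` with chosen finite products, all
finite limits, chosen exponentials, a chosen subobject classifier `S`, and countable colimits. -/

section Subobjects

variable {C : Type u} [Category.{v} C] [HasFiniteLimits C]

/-- The characteristic morphism of a subobject. -/
def chi (S : Subobject.Classifier C) {X : C} (P : Subobject X) : X ⟶ S.Ω := S.χ P.arrow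

theorem pullback_chi (S : Subobject.Classifier C) {X : C} (P : Subobject X) :
    (Subobject.pullback (chi S P)).obj (Subobject.mk S.truth) = P := by
  have := Subobject.Classifier.pullback_χ_obj_mk_truth S P.arrow
  rwa [Subobject.mk_arrow] at this

/-- Two generalised elements agree under `chi` exactly when they have the same restrictions in
the two subobjects. -/
theorem comp_chi_eq_iff (S : Subobject.Classifier C) {X Y : C} (f : Y ⟶ X)
    (P Q : Subobject X) : f ≫ chi S P = f ≫ chi S Q ↔
      ∀ (Z : C) (h : Z ⟶ Y), P.Factors (h ≫ f) ↔ Q.Factors (h ≫ f) := by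
  have hinj : ∀ a b : Y ⟶ S.Ω, (Subobject.pullback a).obj (Subobject.mk S.truth) =
      (Subobject.pullback b).obj (Subobject.mk S.truth) → a = b := fun a b h =>
    S.representableBy.homEquiv.injective h
  constructor
  · intro h Z k
    rw [← pullback_factors_iff, ← pullback_factors_iff, ← pullback_chi S P, ← pullback_chi S Q,
      ← Subobject.pullback_comp, ← Subobject.pullback_comp, h]
  · intro h
    apply hinj
    rw [Subobject.pullback_comp, Subobject.pullback_comp, pullback_chi, pullback_chi]
    apply le_antisymm
    · exact Subobject.le_of_factors ((pullback_factors_iff _ _ _).2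
        ((h _ _).1 ((pullback_factors_iff _ _ _).1 (Subobject.factors_self _))))
    · exact Subobject.le_of_factors ((pullback_factors_iff _ _ _).2
        ((h _ _).2 ((pullback_factors_iff _ _ _).1 (Subobject.factors_self _))))

theorem comp_chi_eq_top_iff (S : Subobject.Classifier C) {X Y : C} (f : Y ⟶ X)
    (P : Subobject X) : f ≫ chi S P = f ≫ chi S ⊤ ↔ P.Factors f := by
  rw [comp_chi_eq_iff]
  constructor
  · intro h
    simpa using (h Y (𝟙 Y)).2 (Subobject.top_factors _)
  · intro h Z k
    exact ⟨fun _ => Subobject.top_factors _, fun _ => Subobject.factors_of_factors_right k h⟩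

/-- The Heyting implication of subobjects, as the equaliser of the characteristic morphisms of
`P ⊓ Q` and `P`; see `le_himp_iff`. -/
def himp (S : Subobject.Classifier C) {X : C} (P Q : Subobject X) : Subobject X :=
  equalizerSubobject (chi S (P ⊓ Q)) (chi S P)

theorem le_himp_iff (S : Subobject.Classifier C) {X : C} (P Q R : Subobject X) :
    R ≤ himp S P Q ↔ R ⊓ P ≤ Q := by
  have h1 : R ≤ himp S P Q ↔ R.arrow ≫ chi S (P ⊓ Q) = R.arrow ≫ chi S P :=
    ⟨fun h => (equalizerSubobject_factors_iff _ _ _).1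
      (Subobject.factors_of_le _ h (Subobject.factors_self R)),
     fun h => Subobject.le_of_factors ((equalizerSubobject_factors_iff _ _ _).2 h)⟩
  rw [h1, comp_chi_eq_iff]
  constructor
  · intro h
    apply Subobject.le_of_factors
    obtain ⟨k, hk⟩ : ∃ k, k ≫ R.arrow = (R ⊓ P).arrow :=
      ⟨_, Subobject.factorThru_arrow R _ (Subobject.inf_arrow_factors_left R P)⟩
    have := (h _ k).2 (hk ▸ Subobject.inf_arrow_factors_right R P)
    rw [hk] at this
    exact Subobject.factors_right_of_inf_factors this
  · intro h Z k
    rw [Subobject.inf_factors]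
    refine ⟨fun h' => h'.1, fun h' => ⟨h', Subobject.factors_of_le _ h ?_⟩⟩
    exact (Subobject.inf_factors _).2 ⟨Subobject.factors_comp_arrow k, h'⟩

variable [HasCountableColimits C]

/-- The image of `f : A ⟶ B`: the equaliser of the cokernel pair `B ⇉ B ⊔_A B` of `f`. -/
def im {A B : C} (f : A ⟶ B) : Subobject B :=
  equalizerSubobject (pushout.inl f f) (pushout.inr f f)

/-- The image of `f` is the least subobject through which `f` factors. -/
theorem im_le_iff (S : Subobject.Classifier C) {A B : C} (f : A ⟶ B) (P : Subobject B) :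
    im f ≤ P ↔ P.Factors f := by
  have hf : (im f).Factors f := (equalizerSubobject_factors_iff _ _ _).2 pushout.condition
  constructor
  · intro h
    exact Subobject.factors_of_le f h hf
  · intro h
    have hw : (im f).arrow ≫ pushout.inl f f = (im f).arrow ≫ pushout.inr f f :=
      equalizerSubobject_arrow_comp _ _
    have key : f ≫ chi S P = f ≫ chi S ⊤ := (comp_chi_eq_top_iff S f P).2 h
    have h2 : (im f).arrow ≫ chi S P = (im f).arrow ≫ chi S ⊤ := by
      have := congrArg (fun k => k ≫ pushout.desc (chi S P) (chi S ⊤) key) hw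
      rwa [Category.assoc, Category.assoc, pushout.inl_desc, pushout.inr_desc] at this
    exact Subobject.le_of_factors ((comp_chi_eq_top_iff S _ P).1 h2)

/-- The join of two subobjects: the image of `P ⨿ Q ⟶ X`. -/
def join {X : C} (P Q : Subobject X) : Subobject X := im (coprod.desc P.arrow Q.arrow)

/-- The join of a sequence of subobjects: the image of `∐ᵢ Pᵢ ⟶ X`. -/
def iJoin {X : C} (P : ℕ → Subobject X) : Subobject X := im (Sigma.desc fun i => (P i).arrow)

variable [CartesianMonoidalCategory C] [MonoidalClosed C]

/-- The least subobject `0 ↣ X`. -/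
def bot (X : C) : Subobject X := Subobject.mk (initial.to X)

variable (S : Subobject.Classifier C)

/-- The power object `Ω ^ A`. -/
abbrev Pow (A : C) : C := (ihom A).obj S.Ω

/-- The membership relation `∈_A ↣ A × Ω ^ A`, classified by the evaluation morphism. -/
def mem (A : C) : Subobject (A ⊗ Pow S A) :=
  (Subobject.pullback ((ihom.ev A).app S.Ω)).obj (Subobject.mk S.truth)

end Subobjects

/-! ### Contexts, terms and formulas

The types of the internal language are the objects of `C`; the product type and the power type are
the chosen product and the chosen exponential. Variables are de Bruijn indices, so that terms and
formulas are automatically taken up to renaming of bound variables. -/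

section Language

/-- Contexts: finite sequences of types. `Γ.cons A` is `Γ` with a variable of type `A` appended. -/
inductive Ctx (C : Type u) : Type u
  | nil : Ctx C
  | cons : Ctx C → C → Ctx C

/-- The context that consists of one variable. -/
abbrev Ctx.one {C : Type u} (A : C) : Ctx C := Ctx.cons Ctx.nil A

/-- The variables of type `A` in a context. -/
inductive Var {C : Type u} : Ctx C → C → Type u
  | last {Γ : Ctx C} {A : C} : Var (Γ.cons A) A
  | prev {Γ : Ctx C} {A B : C} : Var Γ A → Var (Γ.cons B) A

variable {C : Type u} [Category.{v} C] [CartesianMonoidalCategory C] [MonoidalClosed C]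

mutual

/-- The terms of type `A` in context `Γ`. -/
inductive Tm (S : Subobject.Classifier C) : Ctx C → C → Type (max u v)
  | var {Γ : Ctx C} {A : C} : Var Γ A → Tm S Γ A
  | star {Γ : Ctx C} : Tm S Γ (𝟙_ C)
  | pair {Γ : Ctx C} {A B : C} : Tm S Γ A → Tm S Γ B → Tm S Γ (A ⊗ B)
  | fst {Γ : Ctx C} {A B : C} : Tm S Γ (A ⊗ B) → Tm S Γ A
  | snd {Γ : Ctx C} {A B : C} : Tm S Γ (A ⊗ B) → Tm S Γ B
  | app {Γ : Ctx C} {A B : C} : (A ⟶ B) → Tm S Γ A → Tm S Γ B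
  | compr {Γ : Ctx C} (A : C) : Fm S (Γ.cons A) → Tm S Γ (Pow S A)

/-- The formulas in context `Γ`. -/
inductive Fm (S : Subobject.Classifier C) : Ctx C → Type (max u v)
  | rel {Γ : Ctx C} {A : C} : Subobject A → Tm S Γ A → Fm S Γ
  | eq {Γ : Ctx C} {A : C} : Tm S Γ A → Tm S Γ A → Fm S Γ
  | mem {Γ : Ctx C} {A : C} : Tm S Γ A → Tm S Γ (Pow S A) → Fm S Γ
  | top {Γ : Ctx C} : Fm S Γ
  | bot {Γ : Ctx C} : Fm S Γ
  | and {Γ : Ctx C} : Fm S Γ → Fm S Γ → Fm S Γ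
  | or {Γ : Ctx C} : Fm S Γ → Fm S Γ → Fm S Γ
  | imp {Γ : Ctx C} : Fm S Γ → Fm S Γ → Fm S Γ
  | iOr {Γ : Ctx C} : (ℕ → Fm S Γ) → Fm S Γ
  | all {Γ : Ctx C} (A : C) : Fm S (Γ.cons A) → Fm S Γ
  | ex {Γ : Ctx C} (A : C) : Fm S (Γ.cons A) → Fm S Γ

end

/-- Renamings of variables. -/
abbrev Ren (Γ Δ : Ctx C) : Type u := ∀ A : C, Var Γ A → Var Δ A

/-- Extend a renaming by a new variable. -/
def Ren.up {Γ Δ : Ctx C} (r : Ren Γ Δ) (B : C) : Ren (Γ.cons B) (Δ.cons B)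
  | _, .last => .last
  | _, .prev x => .prev (r _ x)

variable {S : Subobject.Classifier C}

mutual

/-- Rename the free variables of a term. -/
def Tm.rename {Γ Δ : Ctx C} {A : C} (r : Ren Γ Δ) (t : Tm S Γ A) : Tm S Δ A :=
  match t with
  | .var x => .var (r _ x)
  | .star => .star
  | .pair t s => .pair (t.rename r) (s.rename r)
  | .fst t => .fst (t.rename r)
  | .snd t => .snd (t.rename r)
  | .app f t => .app f (t.rename r)
  | .compr A p => .compr A (p.rename (r.up A))
termination_by structural t

/-- Rename the free variables of a formula. -/
def Fm.rename {Γ Δ : Ctx C} (r : Ren Γ Δ) (p : Fm S Γ) : Fm S Δ :=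
  match p with
  | .rel R t => .rel R (t.rename r)
  | .eq t s => .eq (t.rename r) (s.rename r)
  | .mem t s => .mem (t.rename r) (s.rename r)
  | .top => .top
  | .bot => .bot
  | .and p q => .and (p.rename r) (q.rename r)
  | .or p q => .or (p.rename r) (q.rename r)
  | .imp p q => .imp (p.rename r) (q.rename r)
  | .iOr p => .iOr fun i => (p i).rename r
  | .all A p => .all A (p.rename (r.up A))
  | .ex A p => .ex A (p.rename (r.up A))
termination_by structural p

end

/-- Regard a term in context `Γ` as a term in a context with one more variable. -/
def Tm.weaken {Γ : Ctx C} {A : C} (B : C) (t : Tm S Γ A) : Tm S (Γ.cons B) A :=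
  t.rename fun _ x => .prev x

end Language

/-! ### The interpretation -/

section Interpretation

variable {C : Type u} [Category.{v} C] [CartesianMonoidalCategory C]

/-- The object `⟦A₁⟧ × ⋯ × ⟦Aₙ⟧` that interprets a context: the terminal object for the empty
context, and `A` itself for the context that consists of one variable of type `A`. -/
def Ctx.obj : Ctx C → C
  | .nil => 𝟙_ C
  | .cons .nil A => A
  | .cons (.cons Γ B) A => Ctx.obj (.cons Γ B) ⊗ A

/-- The projection that forgets the last variable. -/
def Ctx.proj (A : C) : (Γ : Ctx C) → ((Γ.cons A).obj ⟶ Γ.obj)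
  | .nil => toUnit A
  | .cons _ _ => CartesianMonoidalCategory.fst _ _

/-- The projection to the last variable. -/
def Ctx.last (A : C) : (Γ : Ctx C) → ((Γ.cons A).obj ⟶ A)
  | .nil => 𝟙 A
  | .cons _ _ => CartesianMonoidalCategory.snd _ _

/-- The canonical isomorphism from `A × ⟦Γ⟧` to `⟦Γ, a : A⟧`. -/
def Ctx.swap (A : C) : (Γ : Ctx C) → (A ⊗ Γ.obj ⟶ (Γ.cons A).obj)
  | .nil => CartesianMonoidalCategory.fst _ _
  | .cons _ _ => lift (CartesianMonoidalCategory.snd _ _) (CartesianMonoidalCategory.fst _ _)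

/-- Variables are interpreted as projections. -/
def Var.interp : {Γ : Ctx C} → {A : C} → Var Γ A → (Γ.obj ⟶ A)
  | .cons Γ A, _, .last => Ctx.last A Γ
  | .cons Γ B, _, .prev x => Ctx.proj B Γ ≫ Var.interp x

variable [HasFiniteLimits C] [MonoidalClosed C]

/-- The transpose `⟦Γ⟧ ⟶ Ω ^ A` of the characteristic morphism of a subobject of
`⟦Γ, a : A⟧`. -/
def name (S : Subobject.Classifier C) {Γ : Ctx C} {A : C} (P : Subobject (Γ.cons A).obj) :
    Γ.obj ⟶ Pow S A :=
  MonoidalClosed.curry (Ctx.swap A Γ ≫ chi S P)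

/-- Universal quantification along the projection that forgets the last variable, as the equaliser
of the morphisms to `Ω ^ A` named by `P` and by the largest subobject; see `le_forAll_iff`. -/
def forAll (S : Subobject.Classifier C) {Γ : Ctx C} {A : C} (P : Subobject (Γ.cons A).obj) :
    Subobject Γ.obj :=
  equalizerSubobject (name S P) (name S ⊤)

theorem le_forAll_iff (S : Subobject.Classifier C) {Γ : Ctx C} {A : C}
    (P : Subobject (Γ.cons A).obj) (R : Subobject Γ.obj) :
    R ≤ forAll S P ↔ (Subobject.pullback (Ctx.proj A Γ)).obj R ≤ P := by
  have hproj : Ctx.swap A Γ ≫ Ctx.proj A Γ = CartesianMonoidalCategory.snd _ _ := by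
    cases Γ with
    | nil => exact toUnit_unique _ _
    | cons Γ B => exact lift_fst _ _
  have hinv : lift (Ctx.last A Γ) (Ctx.proj A Γ) ≫ Ctx.swap A Γ = 𝟙 _ := by
    cases Γ with
    | nil => exact lift_fst _ _
    | cons Γ B =>
      apply CartesianMonoidalCategory.hom_ext <;> simp [Ctx.swap, Ctx.last, Ctx.proj, Ctx.obj]
  have h1 : R ≤ forAll S P ↔ R.arrow ≫ name S P = R.arrow ≫ name S ⊤ :=
    ⟨fun h => (equalizerSubobject_factors_iff _ _ _).1
      (Subobject.factors_of_le _ h (Subobject.factors_self R)),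
     fun h => Subobject.le_of_factors ((equalizerSubobject_factors_iff _ _ _).2 h)⟩
  rw [h1, name, name, ← MonoidalClosed.curry_natural_left, ← MonoidalClosed.curry_natural_left,
    MonoidalClosed.curry_injective.eq_iff, ← Category.assoc, ← Category.assoc,
    comp_chi_eq_top_iff]
  constructor
  · intro h
    apply Subobject.le_of_factors
    set Q := (Subobject.pullback (Ctx.proj A Γ)).obj R with hQ
    have hf : R.Factors (Q.arrow ≫ Ctx.proj A Γ) :=
      (pullback_factors_iff _ _ _).1 (Subobject.factors_self Q)
    have e : lift (Q.arrow ≫ Ctx.last A Γ) (R.factorThru _ hf) ≫ (A ◁ R.arrow) ≫ Ctx.swap A Γ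
        = Q.arrow := by
      rw [← Category.assoc, lift_whiskerLeft, Subobject.factorThru_arrow, ← comp_lift,
        Category.assoc, hinv, Category.comp_id]
    rw [← e]
    exact Subobject.factors_of_factors_right _ h
  · intro h
    apply Subobject.factors_of_le _ h
    rw [pullback_factors_iff, Category.assoc, hproj, whiskerLeft_snd]
    exact Subobject.factors_comp_arrow _

variable [HasCountableColimits C] {S : Subobject.Classifier C}

mutual

/-- The interpretation of a term as a morphism; the universe lift is there only because the two
simultaneous recursions must take their values in the same universe. -/
def Tm.interpUp {Γ : Ctx C} {A : C} (t : Tm S Γ A) : ULift.{u} (Γ.obj ⟶ A) :=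
  match t with
  | .var x => ⟨x.interp⟩
  | .star => ⟨toUnit _⟩
  | .pair t s => ⟨lift t.interpUp.down s.interpUp.down⟩
  | .fst t => ⟨t.interpUp.down ≫ CartesianMonoidalCategory.fst _ _⟩
  | .snd t => ⟨t.interpUp.down ≫ CartesianMonoidalCategory.snd _ _⟩
  | .app f t => ⟨t.interpUp.down ≫ f⟩
  | .compr _ p => ⟨name S p.interp⟩
termination_by structural t

/-- The interpretation of a formula as a subobject. -/
def Fm.interp {Γ : Ctx C} (p : Fm S Γ) : Subobject Γ.obj :=
  match p with
  | .rel R t => (Subobject.pullback t.interpUp.down).obj R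
  | .eq t s => equalizerSubobject t.interpUp.down s.interpUp.down
  | .mem t s => (Subobject.pullback (lift t.interpUp.down s.interpUp.down)).obj (InternalLogic.mem S _)
  | .top => ⊤
  | .bot => InternalLogic.bot _
  | .and p q => p.interp ⊓ q.interp
  | .or p q => join p.interp q.interp
  | .imp p q => himp S p.interp q.interp
  | .iOr p => iJoin fun i => (p i).interp
  | .all _ p => forAll S p.interp
  | .ex A p => im (p.interp.arrow ≫ Ctx.proj A _)
termination_by structural p

end

/-- The interpretation of a term `t : A` in context `Γ` as a morphism `⟦Γ⟧ ⟶ A`. -/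
def Tm.interp {Γ : Ctx C} {A : C} (t : Tm S Γ A) : Γ.obj ⟶ A := t.interpUp.down

end Interpretation

/-! ### The terms and formulas of interest -/

section Examples

variable {C : Type u} [Category.{v} C] [CartesianMonoidalCategory C] [MonoidalClosed C]
  {S : Subobject.Classifier C}

/-- `{t} := {a' : A | a' = t}`. -/
def Tm.sing {Γ : Ctx C} {A : C} (t : Tm S Γ A) : Tm S Γ (Pow S A) :=
  .compr A (.eq (.var .last) (t.weaken A))

/-- `∅_A := {a : A | ⊥}`. -/
def Tm.empty {Γ : Ctx C} (A : C) : Tm S Γ (Pow S A) := .compr A .bot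

/-- `Z₁ ∪ Z₂ := {u : U | u ∈ Z₁ ∨ u ∈ Z₂}`. -/
def Tm.union {Γ : Ctx C} {U : C} (Z₁ Z₂ : Tm S Γ (Pow S U)) : Tm S Γ (Pow S U) :=
  .compr U (.or (.mem (.var .last) (Z₁.weaken U)) (.mem (.var .last) (Z₂.weaken U)))

/-- `f(Z) := {b : B | ∃ a : A, a ∈ Z ∧ b = f a}`. -/
def Tm.image {Γ : Ctx C} {A B : C} (f : A ⟶ B) (Z : Tm S Γ (Pow S A)) : Tm S Γ (Pow S B) :=
  .compr B (.ex A (.and (.mem (.var .last) ((Z.weaken B).weaken A))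
    (.eq (.var (.prev .last)) (.app f (.var .last)))))

variable (S)

/-- The formula `∃ u : U, z = {u}` in the free variable `z : P U`. -/
def singFormula (U : C) : Fm S (.one (Pow S U)) :=
  .ex U (.eq (.var (.prev .last)) (Tm.sing (.var .last)))

/-- The formula `(∃ a : A, z = ⟨{a}, ∅⟩) ∨ (∃ b : B, z = ⟨∅, {b}⟩)` in the free variable
`z : P A × P B`. -/
def coprodFormula (A B : C) : Fm S (.one (Pow S A ⊗ Pow S B)) :=
  .or (.ex A (.eq (.var (.prev .last)) (.pair (Tm.sing (.var .last)) (Tm.empty B))))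
    (.ex B (.eq (.var (.prev .last)) (.pair (Tm.empty A) (Tm.sing (.var .last)))))

/-- The term `{u}` in the free variable `u : U`. -/
def singTerm (U : C) : Tm S (.one U) (Pow S U) := Tm.sing (.var .last)

/-- The term `⟨z, ∅⟩` in the free variable `z : P A`. -/
def leftTerm (A B : C) : Tm S (.one (Pow S A)) (Pow S A ⊗ Pow S B) :=
  .pair (.var .last) (Tm.empty B)

/-- The term `⟨∅, z⟩` in the free variable `z : P B`. -/
def rightTerm (A B : C) : Tm S (.one (Pow S B)) (Pow S A ⊗ Pow S B) :=
  .pair (Tm.empty A) (.var .last)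

/-- The term `⟨g₀(fst z), g₁(snd z)⟩` in the free variable `z : P A × P B`. -/
def imageTerm {A B U : C} (g₀ : A ⟶ U) (g₁ : B ⟶ U) :
    Tm S (.one (Pow S A ⊗ Pow S B)) (Pow S U ⊗ Pow S U) :=
  .pair (Tm.image g₀ (.fst (.var .last))) (Tm.image g₁ (.snd (.var .last)))

/-- The term `fst u ∪ snd u` in the free variable `u : P U × P U`. -/
def unionTerm (U : C) : Tm S (.one (Pow S U ⊗ Pow S U)) (Pow S U) :=
  Tm.union (.fst (.var .last)) (.snd (.var .last))

end Examples

end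

end InternalLogic

namespace InternalLogic

-- Factorisation criteria for implications and joins of subobjects.

section Factors

-- The ambient category already has a coproduct `A ⨿ B`, so the task is to recognise Q as a copy of
-- it. Let l be a ↦ ⟨{a}, ∅⟩ and r be b ↦ ⟨∅, {b}⟩. The defining formula cuts out the join of the
-- images of l and r, that is, the least subobject through which [l, r] factors
-- (`coprodFormula_le_iff`). Moreover [l, r] is a monomorphism (`mono_desc_singLeft_singRight`):
-- singleton maps are mono, and an equality l(a) = r(b) would put a into ∅. A monomorphism
-- represents its own image, whence Q ≅ `A ⨿ B` over the product of power objects; the same argument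
-- applied to the singleton map gives U ≅ T. Finally g₀(fst z) ∪ g₁(snd z) sends l(a) to {g₀ a} and
-- r(b) to {g₁ b} (`singLeft_imageUnion`, `singRight_imageUnion`), so on Q it is the mediating
-- morphism followed by the singleton map.
--
-- All calculations use generalised elements. Images and joins are given only by universal
-- properties in the poset of subobjects, while eliminating ∃ or ∨ at an arbitrary stage requires
-- stability under base change. `exists_factors_iff` provides this: ∀ and ⇒ yield the subobject R =
-- {b | ∀ z, b = x z → s z = t z}, and the universal property is applied to R. Hence every
-- elimination rule concludes an equation s = t between morphisms. That is enough: belonging to a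
-- subobject is itself an equation of characteristic morphisms, and ⊥ yields every equation.

theorem factors_iff_le_of_mono {C : Type u} [Category.{v} C] {X Y : C} (f : Y ⟶ X) [Mono f]
    (P : Subobject X) :
    P.Factors f ↔ Subobject.mk f ≤ P :=
  ⟨fun h => Subobject.mk_le_of_comm (P.factorThru f h) (P.factorThru_arrow f h),
    fun h => Subobject.factors_of_le f h (Subobject.mk_factors_self f)⟩

variable {C : Type u} [Category.{v} C] [HasFiniteLimits C]

theorem comp_chi (S : Subobject.Classifier C) {X Y : C} (f : Y ⟶ X) (P : Subobject X) :
    f ≫ chi S P = chi S ((Subobject.pullback f).obj P) := by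
  apply S.representableBy.homEquiv.injective
  change (Subobject.pullback _).obj (Subobject.mk S.truth) =
    (Subobject.pullback _).obj (Subobject.mk S.truth)
  rw [Subobject.pullback_comp, pullback_chi, pullback_chi]

theorem comp_chi_eq_comp_chi_iff (S : Subobject.Classifier C) {X X' Y : C} (f : Y ⟶ X)
    (f' : Y ⟶ X') (P : Subobject X) (P' : Subobject X') : f ≫ chi S P = f' ≫ chi S P' ↔
      ∀ (Z : C) (h : Z ⟶ Y), P.Factors (h ≫ f) ↔ P'.Factors (h ≫ f') := by
  rw [comp_chi, comp_chi, ← Category.id_comp (chi S ((Subobject.pullback f).obj P)),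
    ← Category.id_comp (chi S ((Subobject.pullback f').obj P')), comp_chi_eq_iff]
  simp only [Category.comp_id, pullback_factors_iff]

/-- The Kripke–Joyal clause for ⇒: the premise is tested at all later stages h. -/
theorem himp_factors_iff (S : Subobject.Classifier C) {X Y : C} (f : Y ⟶ X)
    (P Q : Subobject X) : (himp S P Q).Factors f ↔
      ∀ (Z : C) (h : Z ⟶ Y), P.Factors (h ≫ f) → Q.Factors (h ≫ f) := by
  rw [himp, equalizerSubobject_factors_iff, comp_chi_eq_iff]
  simp only [Subobject.inf_factors, and_iff_left_iff_imp]

theorem join_le [HasCountableColimits C] (S : Subobject.Classifier C) {X : C} {P Q R : Subobject X}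
    (hP : P ≤ R) (hQ : Q ≤ R) : join P Q ≤ R := by
  rw [join, im_le_iff S]
  have e : coprod.desc P.arrow Q.arrow =
      coprod.desc (Subobject.ofLE P R hP) (Subobject.ofLE Q R hQ) ≫ R.arrow := by
    apply coprod.hom_ext <;> simp
  rw [e]
  exact Subobject.factors_comp_arrow _

theorem left_le_join [HasCountableColimits C] (S : Subobject.Classifier C) {X : C}
    (P Q : Subobject X) : P ≤ join P Q := by
  have h := (im_le_iff S (coprod.desc P.arrow Q.arrow) _).1 le_rfl
  refine Subobject.le_of_factors ?_
  rw [← coprod.inl_desc P.arrow Q.arrow]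
  exact Subobject.factors_of_factors_right coprod.inl h

theorem right_le_join [HasCountableColimits C] (S : Subobject.Classifier C) {X : C}
    (P Q : Subobject X) : Q ≤ join P Q := by
  have h := (im_le_iff S (coprod.desc P.arrow Q.arrow) _).1 le_rfl
  refine Subobject.le_of_factors ?_
  rw [← coprod.inr_desc P.arrow Q.arrow]
  exact Subobject.factors_of_factors_right coprod.inr h

end Factors

/-- Initial objects are strict in a cartesian closed category, so a stage at which ⊥ holds is itself
initial. -/
theorem eq_of_bot_factors {C : Type u} [Category.{v} C] [HasCountableColimits C]
    [CartesianMonoidalCategory C] [MonoidalClosed C] {X Z Y : C} {x : Z ⟶ X}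
    (hx : (bot X).Factors x) (s t : Z ⟶ Y) : s = t := by
  obtain ⟨(g : Z ⟶ ⊥_ C), -⟩ := (Subobject.mk_factors_iff _ _).1 hx
  have := strict_initial initialIsInitial g
  rw [← cancel_epi (inv g)]
  exact initial.hom_ext _ _

-- Generalised elements of contexts and power objects.

section Forcing

variable {C : Type u} [Category.{v} C] [CartesianMonoidalCategory C]

/-- Extend a generalised element of a context by a value of one more variable. -/
def Ctx.ext {Γ : Ctx C} {A Z : C} (f : Z ⟶ Γ.obj) (a : Z ⟶ A) : Z ⟶ (Γ.cons A).obj :=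
  lift a f ≫ Ctx.swap A Γ

@[simp]
theorem Ctx.ext_proj {Γ : Ctx C} {A Z : C} (f : Z ⟶ Γ.obj) (a : Z ⟶ A) :
    Ctx.ext f a ≫ Ctx.proj A Γ = f := by
  cases Γ with
  | nil => exact toUnit_unique _ _
  | cons Γ B => simp [Ctx.ext, Ctx.swap, Ctx.proj, Ctx.obj]

@[simp]
theorem Ctx.ext_last {Γ : Ctx C} {A Z : C} (f : Z ⟶ Γ.obj) (a : Z ⟶ A) :
    Ctx.ext f a ≫ Ctx.last A Γ = a := by
  cases Γ with
  | nil => exact (Category.comp_id _).trans (lift_fst _ _)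
  | cons Γ B => simp [Ctx.ext, Ctx.swap, Ctx.last, Ctx.obj]

@[simp]
theorem Ctx.ext_proj_assoc {Γ : Ctx C} {A Z Y : C} (f : Z ⟶ Γ.obj) (a : Z ⟶ A) (g : Γ.obj ⟶ Y) :
    Ctx.ext f a ≫ Ctx.proj A Γ ≫ g = f ≫ g := by
  rw [← Category.assoc, Ctx.ext_proj]

@[simp]
theorem Ctx.ext_last_assoc {Γ : Ctx C} {A Z Y : C} (f : Z ⟶ Γ.obj) (a : Z ⟶ A) (g : A ⟶ Y) :
    Ctx.ext f a ≫ Ctx.last A Γ ≫ g = a ≫ g := by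
  rw [← Category.assoc, Ctx.ext_last]

theorem Ctx.comp_ext {Γ : Ctx C} {A Z W : C} (k : W ⟶ Z) (f : Z ⟶ Γ.obj) (a : Z ⟶ A) :
    k ≫ Ctx.ext f a = Ctx.ext (k ≫ f) (k ≫ a) := by
  rw [Ctx.ext, Ctx.ext, ← comp_lift, Category.assoc]

theorem Ctx.ext_comp_proj_comp_last {Γ : Ctx C} {A Z : C} (f : Z ⟶ (Γ.cons A).obj) :
    Ctx.ext (f ≫ Ctx.proj A Γ) (f ≫ Ctx.last A Γ) = f := by
  cases Γ with
  | nil => exact (lift_fst _ _).trans (Category.comp_id f)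
  | cons Γ B =>
    apply CartesianMonoidalCategory.hom_ext <;>
      simp [Ctx.ext, Ctx.swap, Ctx.last, Ctx.proj, Ctx.obj]

variable [HasFiniteLimits C] [MonoidalClosed C] (S : Subobject.Classifier C)

theorem chi_mem (A : C) : chi S (mem S A) = (ihom.ev A).app S.Ω := by
  apply S.representableBy.homEquiv.injective
  change (Subobject.pullback _).obj (Subobject.mk S.truth) =
    (Subobject.pullback _).obj (Subobject.mk S.truth)
  rw [pullback_chi]
  rfl

/-- Membership is classified by evaluation, so this is the η-rule for the exponential. -/
theorem eq_curry_chi_mem {A Z : C} (f : Z ⟶ Pow S A) :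
    f = MonoidalClosed.curry (A ◁ f ≫ chi S (mem S A)) := by
  rw [chi_mem, ← MonoidalClosed.uncurry_eq, MonoidalClosed.curry_uncurry]

variable {S}

/-- Extensionality of power objects for generalised elements. -/
theorem pow_ext {A Z : C} {f g : Z ⟶ Pow S A}
    (h : ∀ (W : C) (k : W ⟶ Z) (a : W ⟶ A),
      (mem S A).Factors (lift a (k ≫ f)) ↔ (mem S A).Factors (lift a (k ≫ g))) : f = g := by
  rw [eq_curry_chi_mem S f, eq_curry_chi_mem S g]
  congr 1
  rw [comp_chi_eq_comp_chi_iff]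
  intro W k
  -- A generalised element of `A ⊗ Z` is a pair, and its second component serves as the change of
  -- stage in `h`.
  have e (f : Z ⟶ Pow S A) : k ≫ A ◁ f = lift (k ≫ fst _ _) ((k ≫ snd _ _) ≫ f) := by
    apply CartesianMonoidalCategory.hom_ext <;> simp
  rw [e, e]
  exact h W _ _

/-- The β-rule for comprehension: a ∈ {a | P} at f iff P holds at f extended by a. -/
theorem mem_name_iff {Γ : Ctx C} {A Z : C} (P : Subobject (Γ.cons A).obj) (f : Z ⟶ Γ.obj)
    (a : Z ⟶ A) : (mem S A).Factors (lift a (f ≫ name S P)) ↔ P.Factors (Ctx.ext f a) := by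
  have e : lift a (f ≫ name S P) ≫ chi S (mem S A) = Ctx.ext f a ≫ chi S P := by
    rw [chi_mem, ← lift_whiskerLeft, Category.assoc, ← MonoidalClosed.uncurry_eq, name,
      MonoidalClosed.uncurry_curry, Ctx.ext, Category.assoc]
  simpa using (comp_chi_eq_comp_chi_iff S _ _ _ _).1 e Z (𝟙 Z)

theorem forAll_factors_iff {Γ : Ctx C} {A Z : C} (P : Subobject (Γ.cons A).obj)
    (f : Z ⟶ Γ.obj) : (forAll S P).Factors f ↔
      ∀ (W : C) (k : W ⟶ Z) (a : W ⟶ A), P.Factors (Ctx.ext (k ≫ f) a) := by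
  rw [forAll, equalizerSubobject_factors_iff]
  constructor
  · intro h W k a
    rw [← mem_name_iff, Category.assoc, h, ← Category.assoc, mem_name_iff]
    exact Subobject.top_factors _
  · intro h
    refine pow_ext fun W k a => ?_
    rw [← Category.assoc, ← Category.assoc, mem_name_iff, mem_name_iff]
    exact iff_of_true (h W k a) (Subobject.top_factors _)

/-- For `x : Z ⟶ B` and `s t : Z ⟶ Y`, the subobject `{b : B | ∀ z : Z, b = x z → s z = t z}`
exists, first in the case that `B` interprets a context. -/
theorem exists_factors_iff_of_ctx (S : Subobject.Classifier C) {Γ : Ctx C} {Z Y : C}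
    (x : Z ⟶ Γ.obj) (s t : Z ⟶ Y) : ∃ R : Subobject Γ.obj, ∀ (W : C) (y : W ⟶ Γ.obj),
      R.Factors y ↔ ∀ (V : C) (k : V ⟶ W) (z : V ⟶ Z), k ≫ y = z ≫ x → z ≫ s = z ≫ t := by
  -- The universally quantified variable z : Z is the last one of the context `Γ.cons Z`, and y is
  -- the rest.
  refine ⟨forAll S (himp S (equalizerSubobject (Ctx.proj Z Γ) (Ctx.last Z Γ ≫ x))
    (equalizerSubobject (Ctx.last Z Γ ≫ s) (Ctx.last Z Γ ≫ t))), fun W y => ?_⟩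
  rw [forAll_factors_iff]
  simp only [himp_factors_iff, equalizerSubobject_factors_iff, Category.assoc, Ctx.ext_proj,
    Ctx.ext_last_assoc]
  constructor
  · intro h V k z e
    simpa using h V k z V (𝟙 V) (by simpa using e)
  · intro h V k z V' l e
    simpa using h V' (l ≫ k) (l ≫ z) (by simpa using e)

theorem exists_factors_iff (S : Subobject.Classifier C) {B Z Y : C} (x : Z ⟶ B) (s t : Z ⟶ Y) :
    ∃ R : Subobject B, ∀ (W : C) (y : W ⟶ B),
      R.Factors y ↔ ∀ (V : C) (k : V ⟶ W) (z : V ⟶ Z), k ≫ y = z ≫ x → z ≫ s = z ≫ t :=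
  exists_factors_iff_of_ctx S (Γ := .one B) x s t

-- Elimination rules for images, coproducts and joins.

section Elimination

variable [HasCountableColimits C]

/-- Epimorphisms onto an image stay epimorphic after base change. -/
theorem eq_of_im_factors (S : Subobject.Classifier C) {A B Z Y : C} {f : A ⟶ B} {x : Z ⟶ B}
    (hx : (im f).Factors x)
    {s t : Z ⟶ Y}
    (h : ∀ (W : C) (k : W ⟶ Z) (a : W ⟶ A), k ≫ x = a ≫ f → k ≫ s = k ≫ t) : s = t := by
  obtain ⟨R, hR⟩ := exists_factors_iff S x s t
  -- R contains f because the hypothesis covers every z lying over a value of f. At x itself, R then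
  -- gives s = t on taking z to be the identity.
  have hle : im f ≤ R :=
    (im_le_iff S f _).2 ((hR _ f).2
      fun V k z e => h V z k e.symm)
  simpa using (hR _ x).1 (Subobject.factors_of_le x hle hx) Z
    (𝟙 Z) (𝟙 Z) rfl

/-- Universality of coproducts: locally, every element of `A ⨿ B` comes from A or from B. -/
theorem eq_of_eq_on_coprod (S : Subobject.Classifier C) {A B Z Y : C} (x : Z ⟶ A ⨿ B) {s t : Z ⟶ Y}
    (hl : ∀ (W : C) (k : W ⟶ Z) (a : W ⟶ A), k ≫ x = a ≫ coprod.inl → k ≫ s = k ≫ t)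
    (hr : ∀ (W : C) (k : W ⟶ Z) (b : W ⟶ B), k ≫ x = b ≫ coprod.inr → k ≫ s = k ≫ t) :
    s = t := by
  obtain ⟨R, hR⟩ := exists_factors_iff S x s t
  have h1 : R.Factors coprod.inl := (hR _ coprod.inl).2
    fun V k z e => hl V z k e.symm
  have h2 : R.Factors coprod.inr := (hR _ coprod.inr).2
    fun V k z e => hr V z k e.symm
  -- R contains both injections, so its inclusion has a section and R is everything.
  have h3 : coprod.desc (R.factorThru _ h1) (R.factorThru _ h2) ≫ R.arrow = 𝟙 _ := by
    apply coprod.hom_ext <;> simp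
  have h4 : R.Factors x := by
    rw [← Category.comp_id x, ← h3, ← Category.assoc]
    exact Subobject.factors_comp_arrow _
  simpa using (hR _ x).1 h4 Z (𝟙 Z) (𝟙 Z) rfl

theorem eq_of_join_factors (S : Subobject.Classifier C) {X Z Y : C} {P Q : Subobject X} {x : Z ⟶ X}
    (hx : (join P Q).Factors x) {s t : Z ⟶ Y}
    (hP : ∀ (W : C) (k : W ⟶ Z), P.Factors (k ≫ x) → k ≫ s = k ≫ t)
    (hQ : ∀ (W : C) (k : W ⟶ Z), Q.Factors (k ≫ x) → k ≫ s = k ≫ t) : s = t := by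
  obtain ⟨R, hR⟩ := exists_factors_iff S x s t
  have hle : join P Q ≤ R := by
    refine join_le S (Subobject.le_of_factors ?_) (Subobject.le_of_factors ?_)
    · exact (hR _ P.arrow).2
        fun V k z e => hP V z (e ▸ Subobject.factors_comp_arrow k)
    · exact (hR _ Q.arrow).2
        fun V k z e => hQ V z (e ▸ Subobject.factors_comp_arrow k)
  simpa using (hR _ x).1 (Subobject.factors_of_le x hle hx) Z
    (𝟙 Z) (𝟙 Z) rfl

end Elimination

-- Forcing clauses for formulas, singletons, ∅, direct images and unions.

section Interpretation

variable [HasCountableColimits C]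

theorem interp_eq_factors_iff {Γ : Ctx C} {A Z : C} (t s : Tm S Γ A) (f : Z ⟶ Γ.obj) :
    (Fm.eq t s).interp.Factors f ↔ f ≫ t.interp = f ≫ s.interp :=
  equalizerSubobject_factors_iff _ _ _

theorem interp_mem_factors_iff {Γ : Ctx C} {A Z : C} (t : Tm S Γ A) (s : Tm S Γ (Pow S A))
    (f : Z ⟶ Γ.obj) : (Fm.mem t s).interp.Factors f ↔
      (mem S A).Factors (lift (f ≫ t.interp) (f ≫ s.interp)) := by
  rw [← comp_lift]
  exact pullback_factors_iff _ _ _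

theorem interp_and_factors_iff {Γ : Ctx C} {Z : C} (p q : Fm S Γ) (f : Z ⟶ Γ.obj) :
    (Fm.and p q).interp.Factors f ↔ p.interp.Factors f ∧ q.interp.Factors f :=
  Subobject.inf_factors _

theorem interp_or_factors_left {Γ : Ctx C} {Z : C} {p : Fm S Γ} (q : Fm S Γ) {f : Z ⟶ Γ.obj}
    (h : p.interp.Factors f) : (Fm.or p q).interp.Factors f :=
  Subobject.factors_of_le f (left_le_join S _ _) h

theorem interp_or_factors_right {Γ : Ctx C} {Z : C} (p : Fm S Γ) {q : Fm S Γ} {f : Z ⟶ Γ.obj}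
    (h : q.interp.Factors f) : (Fm.or p q).interp.Factors f :=
  Subobject.factors_of_le f (right_le_join S _ _) h

theorem eq_of_interp_or_factors {Γ : Ctx C} {Z Y : C} {p q : Fm S Γ} {f : Z ⟶ Γ.obj}
    (hf : (Fm.or p q).interp.Factors f) {s t : Z ⟶ Y}
    (hp : ∀ (W : C) (k : W ⟶ Z), p.interp.Factors (k ≫ f) → k ≫ s = k ≫ t)
    (hq : ∀ (W : C) (k : W ⟶ Z), q.interp.Factors (k ≫ f) → k ≫ s = k ≫ t) : s = t :=
  eq_of_join_factors S hf hp hq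

theorem interp_ex_le_iff {Γ : Ctx C} {A : C} (p : Fm S (Γ.cons A)) (P : Subobject Γ.obj) :
    (Fm.ex A p).interp ≤ P ↔ P.Factors (p.interp.arrow ≫ Ctx.proj A Γ) :=
  im_le_iff S _ _

theorem interp_ex_factors {Γ : Ctx C} {A Z : C} {p : Fm S (Γ.cons A)} {f : Z ⟶ Γ.obj}
    (a : Z ⟶ A) (h : p.interp.Factors (Ctx.ext f a)) : (Fm.ex A p).interp.Factors f := by
  have := Subobject.factors_of_factors_right (p.interp.factorThru _ h)
    ((interp_ex_le_iff p _).1 le_rfl)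
  simpa using this

theorem eq_of_interp_ex_factors {Γ : Ctx C} {A Z Y : C} {p : Fm S (Γ.cons A)} {f : Z ⟶ Γ.obj}
    (hf : (Fm.ex A p).interp.Factors f) {s t : Z ⟶ Y}
    (h : ∀ (W : C) (k : W ⟶ Z) (a : W ⟶ A), p.interp.Factors (Ctx.ext (k ≫ f) a) →
      k ≫ s = k ≫ t) : s = t := by
  -- An element of the image comes locally from an element of `p.interp`; the witness is its last
  -- coordinate.
  refine eq_of_im_factors S hf fun W k a e => h W k (a ≫ p.interp.arrow ≫ Ctx.last A Γ) ?_
  rw [e, ← Category.assoc, ← Category.assoc, Ctx.ext_comp_proj_comp_last]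
  exact Subobject.factors_comp_arrow _

theorem mem_interp_compr_iff {Γ : Ctx C} {A Z : C} (p : Fm S (Γ.cons A)) (f : Z ⟶ Γ.obj)
    (a : Z ⟶ A) : (mem S A).Factors (lift a (f ≫ (Tm.compr A p).interp)) ↔
      p.interp.Factors (Ctx.ext f a) :=
  mem_name_iff _ _ _

theorem interp_last {Γ : Ctx C} {A : C} :
    (Tm.var (S := S) (Var.last (Γ := Γ) (A := A))).interp = Ctx.last A Γ := rfl

theorem interp_prev {Γ : Ctx C} {A B : C} (x : Var Γ A) :
    (Tm.var (S := S) (Var.prev (B := B) x)).interp = Ctx.proj B Γ ≫ (Tm.var (S := S) x).interp :=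
  rfl

theorem interp_pair {Γ : Ctx C} {A B : C} (t : Tm S Γ A) (s : Tm S Γ B) :
    (Tm.pair t s).interp = lift t.interp s.interp := rfl

theorem interp_app {Γ : Ctx C} {A B : C} (g : A ⟶ B) (t : Tm S Γ A) :
    (Tm.app g t).interp = t.interp ≫ g := rfl

theorem mem_interp_sing_iff {Γ : Ctx C} {A Z : C} (a : Z ⟶ A) (f : Z ⟶ (Γ.cons A).obj) :
    (mem S A).Factors (lift a (f ≫ (Tm.sing (.var (S := S) (.last (Γ := Γ)))).interp)) ↔
      a = f ≫ Ctx.last A Γ := by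
  rw [Tm.sing, mem_interp_compr_iff, interp_eq_factors_iff]
  change Ctx.ext f a ≫ Ctx.last A (Γ.cons A) =
    Ctx.ext f a ≫ Ctx.proj A (Γ.cons A) ≫ Ctx.last A Γ ↔ _
  rw [Ctx.ext_last, Ctx.ext_proj_assoc]

variable (S) in
/-- The singleton morphism, as a morphism out of `A`. -/
noncomputable def singleton (A : C) : A ⟶ Pow S A := (singTerm S A).interp

theorem mem_singleton_iff {A Z : C} (a x : Z ⟶ A) :
    (mem S A).Factors (lift a (x ≫ singleton S A)) ↔ a = x :=
  (mem_interp_sing_iff (Γ := .nil) a x).trans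
    (Eq.congr_right (Category.comp_id x))

instance mono_singleton (A : C) : Mono (singleton S A) where
  right_cancellation x y h := by
    rw [← mem_singleton_iff (S := S), ← h, mem_singleton_iff]

theorem interp_sing_last {Γ : Ctx C} {A : C} :
    (Tm.sing (.var (S := S) (.last (Γ := Γ) (A := A)))).interp =
      Ctx.last A Γ ≫ singleton S A := by
  refine pow_ext fun W k a => ?_
  rw [← Category.assoc, mem_singleton_iff, mem_interp_sing_iff]

theorem eq_of_mem_interp_empty {Γ : Ctx C} {A Z Y : C} {f : Z ⟶ Γ.obj} {a : Z ⟶ A}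
    (h : (mem S A).Factors (lift a (f ≫ (Tm.empty (S := S) A).interp))) (s t : Z ⟶ Y) : s = t :=
  eq_of_bot_factors ((mem_interp_compr_iff _ _ _).1 h) s t

/-- ∅ does not depend on the context: a member of either side proves anything, in particular
membership in the other side, restated as an equation of characteristic morphisms. -/
theorem comp_interp_empty {Γ Δ : Ctx C} {A Z : C} (f : Z ⟶ Γ.obj) (g : Z ⟶ Δ.obj) :
    f ≫ (Tm.empty (S := S) A).interp = g ≫ (Tm.empty (S := S) A).interp := by
  refine pow_ext fun W k a => ⟨fun h => ?_, fun h => ?_⟩ <;>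
  · rw [← Category.assoc] at h
    exact (comp_chi_eq_top_iff S _ _).1 (eq_of_mem_interp_empty h _ _)

variable (S) in
/-- The constant morphism with value `∅`. -/
noncomputable def emptyMap (Z A : C) : Z ⟶ Pow S A :=
  (Tm.empty (S := S) (Γ := .one Z) A).interp

theorem comp_emptyMap {Z Z' A : C} (f : Z ⟶ Z') : f ≫ emptyMap S Z' A = emptyMap S Z A :=
  (comp_interp_empty (Γ := .one Z') (Δ := .one Z) f (𝟙 Z)).trans (Category.id_comp _)

theorem interp_empty (Γ : Ctx C) (A : C) :
    (Tm.empty (S := S) (Γ := Γ) A).interp = emptyMap S Γ.obj A :=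
  (Category.id_comp _).symm.trans
    ((comp_interp_empty (Δ := .one Γ.obj) (𝟙 Γ.obj) (𝟙 Γ.obj)).trans (Category.id_comp _))

theorem eq_of_mem_emptyMap {A Z Y : C} {a : Z ⟶ A}
    (h : (mem S A).Factors (lift a (emptyMap S Z A))) (s t : Z ⟶ Y) : s = t := by
  rw [← Category.id_comp (emptyMap S Z A)] at h
  exact eq_of_mem_interp_empty (Γ := .one Z) h s t

theorem interp_weaken_fst_var {Γ : Ctx C} {A B : C} (D : C) (x : Var Γ (A ⊗ B)) :
    ((Tm.fst (.var (S := S) x)).weaken D).interp =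
      Ctx.proj D Γ ≫ (Tm.fst (.var (S := S) x)).interp :=
  Category.assoc _ _ _

theorem interp_weaken_snd_var {Γ : Ctx C} {A B : C} (D : C) (x : Var Γ (A ⊗ B)) :
    ((Tm.snd (.var (S := S) x)).weaken D).interp =
      Ctx.proj D Γ ≫ (Tm.snd (.var (S := S) x)).interp :=
  Category.assoc _ _ _

theorem interp_weaken_weaken_fst_var {Γ : Ctx C} {A B : C} (D E : C) (x : Var Γ (A ⊗ B)) :
    (((Tm.fst (.var (S := S) x)).weaken D).weaken E).interp =
      Ctx.proj E (Γ.cons D) ≫ Ctx.proj D Γ ≫ (Tm.fst (.var (S := S) x)).interp :=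
  (interp_weaken_fst_var E (.prev x)).trans (congrArg _ (interp_weaken_fst_var D x))

theorem interp_weaken_weaken_snd_var {Γ : Ctx C} {A B : C} (D E : C) (x : Var Γ (A ⊗ B)) :
    (((Tm.snd (.var (S := S) x)).weaken D).weaken E).interp =
      Ctx.proj E (Γ.cons D) ≫ Ctx.proj D Γ ≫ (Tm.snd (.var (S := S) x)).interp :=
  (interp_weaken_snd_var E (.prev x)).trans (congrArg _ (interp_weaken_snd_var D x))

/-- The hypothesis `ht` says that weakening the set term is interpreted by projecting; it is
supplied below for the projections of a variable. -/
theorem mem_interp_image {Γ : Ctx C} {A B Z : C} (g : A ⟶ B) {t : Tm S Γ (Pow S A)}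
    (ht : ((t.weaken B).weaken A).interp = Ctx.proj A (Γ.cons B) ≫ Ctx.proj B Γ ≫ t.interp)
    {f : Z ⟶ Γ.obj} {a : Z ⟶ A} (h : (mem S A).Factors (lift a (f ≫ t.interp))) :
    (mem S B).Factors (lift (a ≫ g) (f ≫ (Tm.image g t).interp)) := by
  rw [Tm.image, mem_interp_compr_iff]
  refine interp_ex_factors a ?_
  rw [interp_and_factors_iff, interp_mem_factors_iff, interp_eq_factors_iff, ht, interp_app,
    interp_prev, interp_last, interp_last]
  simpa using h

theorem eq_of_mem_interp_image {Γ : Ctx C} {A B Z Y : C} {g : A ⟶ B} {t : Tm S Γ (Pow S A)}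
    (ht : ((t.weaken B).weaken A).interp = Ctx.proj A (Γ.cons B) ≫ Ctx.proj B Γ ≫ t.interp)
    {f : Z ⟶ Γ.obj} {b : Z ⟶ B} (hb : (mem S B).Factors (lift b (f ≫ (Tm.image g t).interp)))
    {x y : Z ⟶ Y} (h : ∀ (W : C) (k : W ⟶ Z) (a : W ⟶ A),
      (mem S A).Factors (lift a (k ≫ f ≫ t.interp)) → k ≫ b = a ≫ g → k ≫ x = k ≫ y) :
    x = y := by
  rw [Tm.image, mem_interp_compr_iff] at hb
  refine eq_of_interp_ex_factors hb fun W k a hk => ?_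
  rw [interp_and_factors_iff, interp_mem_factors_iff, interp_eq_factors_iff, ht, interp_app,
    interp_prev, interp_last, interp_last, Ctx.comp_ext] at hk
  exact h W k a (by simpa using hk.1) (by simpa using hk.2)

theorem mem_interp_union_left {Γ : Ctx C} {A Z : C} {t s : Tm S Γ (Pow S A)}
    (ht : (t.weaken A).interp = Ctx.proj A Γ ≫ t.interp) {f : Z ⟶ Γ.obj} {a : Z ⟶ A}
    (h : (mem S A).Factors (lift a (f ≫ t.interp))) :
    (mem S A).Factors (lift a (f ≫ (Tm.union t s).interp)) := by
  rw [Tm.union, mem_interp_compr_iff]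
  refine interp_or_factors_left _ ?_
  rw [interp_mem_factors_iff, ht, interp_last]
  simpa using h

theorem mem_interp_union_right {Γ : Ctx C} {A Z : C} {t s : Tm S Γ (Pow S A)}
    (hs : (s.weaken A).interp = Ctx.proj A Γ ≫ s.interp) {f : Z ⟶ Γ.obj} {a : Z ⟶ A}
    (h : (mem S A).Factors (lift a (f ≫ s.interp))) :
    (mem S A).Factors (lift a (f ≫ (Tm.union t s).interp)) := by
  rw [Tm.union, mem_interp_compr_iff]
  refine interp_or_factors_right _ ?_
  rw [interp_mem_factors_iff, hs, interp_last]
  simpa using h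

theorem eq_of_mem_interp_union {Γ : Ctx C} {A Z Y : C} {t s : Tm S Γ (Pow S A)}
    (ht : (t.weaken A).interp = Ctx.proj A Γ ≫ t.interp)
    (hs : (s.weaken A).interp = Ctx.proj A Γ ≫ s.interp) {f : Z ⟶ Γ.obj} {a : Z ⟶ A}
    (ha : (mem S A).Factors (lift a (f ≫ (Tm.union t s).interp))) {x y : Z ⟶ Y}
    (hl : ∀ (W : C) (k : W ⟶ Z), (mem S A).Factors (lift (k ≫ a) (k ≫ f ≫ t.interp)) →
      k ≫ x = k ≫ y)
    (hr : ∀ (W : C) (k : W ⟶ Z), (mem S A).Factors (lift (k ≫ a) (k ≫ f ≫ s.interp)) →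
      k ≫ x = k ≫ y) : x = y := by
  rw [Tm.union, mem_interp_compr_iff] at ha
  refine eq_of_interp_or_factors ha (fun W k hk => hl W k ?_) (fun W k hk => hr W k ?_)
  · rw [interp_mem_factors_iff, ht, interp_last, Ctx.comp_ext] at hk
    simpa using hk
  · rw [interp_mem_factors_iff, hs, interp_last, Ctx.comp_ext] at hk
    simpa using hk

end Interpretation

end Forcing
-- The subobjects Q and T as images of monomorphisms.
section Coproduct

/-- The hypothesis makes P the image of f, and the image of a monomorphism is the subobject it
represents. -/
theorem exists_iso_of_le_iff {C : Type u} [Category.{v} C] {X Y : C} {P : Subobject X}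
    (f : Y ⟶ X) [Mono f]
    (h : ∀ R : Subobject X, P ≤ R ↔ R.Factors f) :
    ∃ e : Y ≅ (P : C), e.hom ≫ P.arrow = f := by
  obtain rfl : P = Subobject.mk f := le_antisymm ((h _).2 (Subobject.mk_factors_self f))
    ((factors_iff_le_of_mono f P).1 ((h P).1 le_rfl))
  exact ⟨(Subobject.underlyingIso f).symm, by simp⟩

variable {C : Type u} [Category.{v} C] [CartesianMonoidalCategory C] [HasFiniteLimits C]
  [MonoidalClosed C] (S : Subobject.Classifier C) [HasCountableColimits C]

/-- The morphism `a ↦ ⟨{a}, ∅⟩`. -/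
noncomputable def singLeft (A B : C) : A ⟶ Pow S A ⊗ Pow S B :=
  lift (singleton S A) (emptyMap S A B)

/-- The morphism `b ↦ ⟨∅, {b}⟩`. -/
noncomputable def singRight (A B : C) : B ⟶ Pow S A ⊗ Pow S B :=
  lift (emptyMap S B A) (singleton S B)

theorem singTerm_comp_leftTerm (A B : C) :
    (singTerm S A).interp ≫ (leftTerm S A B).interp = singLeft S A B :=
  (comp_lift (singleton S A) (𝟙 (Pow S A)) (emptyMap S (Pow S A) B)).trans
    (congrArg₂ lift (Category.comp_id _) (comp_emptyMap _))

theorem singTerm_comp_rightTerm (A B : C) :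
    (singTerm S B).interp ≫ (rightTerm S A B).interp = singRight S A B :=
  (comp_lift (singleton S B) (emptyMap S (Pow S B) A) (𝟙 (Pow S B))).trans
    (congrArg₂ lift (comp_emptyMap _) (Category.comp_id _))

@[simp]
theorem singLeft_fst (A B : C) : singLeft S A B ≫ fst _ _ = singleton S A := by
  rw [singLeft, lift_fst]

@[simp]
theorem singRight_snd (A B : C) : singRight S A B ≫ snd _ _ = singleton S B := by
  rw [singRight, lift_snd]

variable {S}

theorem eq_of_mem_singLeft_snd {A B Z Y : C} {x : Z ⟶ A} {b : Z ⟶ B}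
    (h : (mem S B).Factors (lift b (x ≫ singLeft S A B ≫ snd _ _))) (s t : Z ⟶ Y) : s = t := by
  rw [singLeft, lift_snd, comp_emptyMap] at h
  exact eq_of_mem_emptyMap h s t

theorem eq_of_mem_singRight_fst {A B Z Y : C} {x : Z ⟶ B} {a : Z ⟶ A}
    (h : (mem S A).Factors (lift a (x ≫ singRight S A B ≫ fst _ _))) (s t : Z ⟶ Y) : s = t := by
  rw [singRight, lift_fst, comp_emptyMap] at h
  exact eq_of_mem_emptyMap h s t

instance mono_singLeft (A B : C) : Mono (singLeft S A B) :=
  haveI : Mono (singLeft S A B ≫ fst _ _) := by rw [singLeft_fst]; infer_instance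
  mono_of_mono _ (fst _ _)

instance mono_singRight (A B : C) : Mono (singRight S A B) :=
  haveI : Mono (singRight S A B ≫ snd _ _) := by rw [singRight_snd]; infer_instance
  mono_of_mono _ (snd _ _)

/-- `{a}` and `∅` are disjoint. -/
theorem eq_of_comp_singLeft_eq_comp_singRight {A B Z Y : C} {a : Z ⟶ A} {b : Z ⟶ B}
    (h : a ≫ singLeft S A B = b ≫ singRight S A B) (s t : Z ⟶ Y) : s = t := by
  have h' : singleton S A = singLeft S A B ≫ fst _ _ := (singLeft_fst S A B).symm
  have ha := (mem_singleton_iff (S := S) a a).2 rfl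
  -- The true statement a ∈ {a} becomes a ∈ ∅ after comparing first components.
  rw [h', ← Category.assoc, h, Category.assoc] at ha
  exact eq_of_mem_singRight_fst ha s t

instance mono_desc_singLeft_singRight (A B : C) :
    Mono (coprod.desc (singLeft S A B) (singRight S A B)) where
  right_cancellation x y h := by
    have key {W : C} {k l : W ⟶ A ⨿ B} {X Y : C} {a : W ⟶ X} {b : W ⟶ Y} {i : X ⟶ A ⨿ B}
        {j : Y ⟶ A ⨿ B} (hk : k = a ≫ i) (hl : l = b ≫ j)
        (h : k ≫ coprod.desc (singLeft S A B) (singRight S A B) =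
          l ≫ coprod.desc (singLeft S A B) (singRight S A B)) :
        a ≫ i ≫ coprod.desc (singLeft S A B) (singRight S A B) =
          b ≫ j ≫ coprod.desc (singLeft S A B) (singRight S A B) := by
      rw [← Category.assoc, ← Category.assoc, ← hk, ← hl, h]
    -- Both elements are localised to summands. Equal summands cancel a singleton map; different
    -- summands are impossible by disjointness.
    refine eq_of_eq_on_coprod S x (fun W k a hx => ?_) (fun W k b hx => ?_)
    · refine eq_of_eq_on_coprod S (k ≫ y) (fun V l a' hy => ?_) (fun V l b' hy => ?_)
      · have h' := key (k := l ≫ k ≫ x) (a := l ≫ a) (by rw [hx, Category.assoc]) hy (by simp [h])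
        rw [coprod.inl_desc, cancel_mono] at h'
        rw [hy, hx, ← h', Category.assoc]
      · have h' := key (k := l ≫ k ≫ x) (a := l ≫ a) (by rw [hx, Category.assoc]) hy (by simp [h])
        rw [coprod.inl_desc, coprod.inr_desc] at h'
        exact eq_of_comp_singLeft_eq_comp_singRight h' _ _
    · refine eq_of_eq_on_coprod S (k ≫ y) (fun V l a' hy => ?_) (fun V l b' hy => ?_)
      · have h' := key (k := l ≫ k ≫ x) (a := l ≫ b) (by rw [hx, Category.assoc]) hy (by simp [h])
        rw [coprod.inl_desc, coprod.inr_desc] at h'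
        exact eq_of_comp_singLeft_eq_comp_singRight h'.symm _ _
      · have h' := key (k := l ≫ k ≫ x) (a := l ≫ b) (by rw [hx, Category.assoc]) hy (by simp [h])
        rw [coprod.inr_desc, cancel_mono] at h'
        rw [hy, hx, ← h', Category.assoc]

/-- `{x : X | ∃ a : A, x = σ a}` is the image of `σ`. -/
theorem interp_ex_eq_le_iff {X A : C} {s : Tm S ((Ctx.one X).cons A) X} {σ : A ⟶ X}
    (hs : s.interp = Ctx.last A (.one X) ≫ σ) (P : Subobject (Ctx.one X).obj) :
    (Fm.ex A (.eq (.var (.prev .last)) s)).interp ≤ P ↔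
      Subobject.Factors (Y := (Ctx.one X).obj) P σ := by
  have hv : (Tm.var (S := S) (.prev (B := A) (.last (Γ := .nil) (A := X)))).interp =
      Ctx.proj A (.one X) := Category.comp_id _
  constructor
  · intro h
    -- At stage A with the element σ, the witness is the generic element of A.
    refine Subobject.factors_of_le _ h (interp_ex_factors (𝟙 A) ?_)
    rw [interp_eq_factors_iff, hs, hv]
    exact (Ctx.ext_proj (Γ := .one X) σ (𝟙 A)).trans
      ((Ctx.ext_last_assoc (Γ := .one X) σ (𝟙 A) σ).trans (Category.id_comp σ)).symm
  · intro h
    rw [interp_ex_le_iff]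
    set R := (Fm.eq (.var (.prev .last)) s).interp
    have e : R.arrow ≫ Ctx.proj A (.one X) = (R.arrow ≫ Ctx.last A (.one X)) ≫ σ := by
      have := (interp_eq_factors_iff _ s _).1 (Subobject.factors_self R)
      rw [hv, hs, ← Category.assoc] at this
      exact this
    rw [e]
    exact Subobject.factors_of_factors_right _ h

theorem exists_iso_singFormula (U : C) :
    ∃ e : U ≅ ((singFormula S U).interp : C),
      e.hom ≫ (singFormula S U).interp.arrow = singleton S U :=
  exists_iso_of_le_iff (X := Pow S U) (singleton S U) fun R =>
    interp_ex_eq_le_iff interp_sing_last R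

theorem coprodFormula_le_iff (A B : C) (R : Subobject (Pow S A ⊗ Pow S B)) :
    (coprodFormula S A B).interp ≤ R ↔
      R.Factors (coprod.desc (singLeft S A B) (singRight S A B)) := by
  have hl : (Tm.pair (Tm.sing (.var (S := S) (.last (Γ := .one (Pow S A ⊗ Pow S B)) (A := A))))
      (Tm.empty B)).interp = Ctx.last A _ ≫ singLeft S A B := by
    rw [interp_pair, interp_sing_last, interp_empty, singLeft, comp_lift, comp_emptyMap]
  have hr : (Tm.pair (Tm.empty A)
      (Tm.sing (.var (S := S) (.last (Γ := .one (Pow S A ⊗ Pow S B)) (A := B))))).interp =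
      Ctx.last B _ ≫ singRight S A B := by
    rw [interp_pair, interp_sing_last, interp_empty, singRight, comp_lift, comp_emptyMap]
  constructor
  · intro h
    have h1 := (interp_ex_eq_le_iff hl R).1 ((left_le_join S _ _).trans h)
    have h2 := (interp_ex_eq_le_iff hr R).1 ((right_le_join S _ _).trans h)
    have e : coprod.desc (R.factorThru _ h1) (R.factorThru _ h2) ≫ R.arrow =
        coprod.desc (singLeft S A B) (singRight S A B) := by
      apply coprod.hom_ext
      · rw [coprod.inl_desc, coprod.inl_desc_assoc]
        exact Subobject.factorThru_arrow _ _ _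
      · rw [coprod.inr_desc, coprod.inr_desc_assoc]
        exact Subobject.factorThru_arrow _ _ _
    rw [← e]
    exact Subobject.factors_comp_arrow _
  · intro h
    refine join_le S ((interp_ex_eq_le_iff hl R).2 ?_) ((interp_ex_eq_le_iff hr R).2 ?_)
    · have := Subobject.factors_of_factors_right coprod.inl h
      rwa [coprod.inl_desc] at this
    · have := Subobject.factors_of_factors_right coprod.inr h
      rwa [coprod.inr_desc] at this

theorem exists_iso_coprodFormula (A B : C) :
    ∃ e : A ⨿ B ≅ ((coprodFormula S A B).interp : C),
      e.hom ≫ (coprodFormula S A B).interp.arrow =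
        coprod.desc (singLeft S A B) (singRight S A B) :=
  exists_iso_of_le_iff (X := Pow S A ⊗ Pow S B) _ (coprodFormula_le_iff A B)

-- The morphism z ↦ g₀(fst z) ∪ g₁(snd z) on singletons.

variable (S) in
/-- The morphism `z ↦ g(fst z)`. -/
noncomputable def imageFst {A U : C} (B : C) (g : A ⟶ U) : Pow S A ⊗ Pow S B ⟶ Pow S U :=
  (Tm.image (S := S) (Γ := .one (Pow S A ⊗ Pow S B)) g (.fst (.var .last))).interp

variable (S) in
/-- The morphism `z ↦ g(snd z)`. -/
noncomputable def imageSnd {B U : C} (A : C) (g : B ⟶ U) : Pow S A ⊗ Pow S B ⟶ Pow S U :=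
  (Tm.image (S := S) (Γ := .one (Pow S A ⊗ Pow S B)) g (.snd (.var .last))).interp

variable (S) in
/-- The morphism `u ↦ fst u ∪ snd u`. -/
noncomputable def unionMap (U : C) : Pow S U ⊗ Pow S U ⟶ Pow S U := (unionTerm S U).interp

theorem comp_interp_fst_last {X Y Z : C} (z : Z ⟶ X ⊗ Y) :
    z ≫ (Tm.fst (.var (S := S) (.last (Γ := .nil) (A := X ⊗ Y)))).interp = z ≫ fst X Y :=
  congrArg (z ≫ ·) (Category.id_comp (fst X Y))

theorem comp_interp_snd_last {X Y Z : C} (z : Z ⟶ X ⊗ Y) :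
    z ≫ (Tm.snd (.var (S := S) (.last (Γ := .nil) (A := X ⊗ Y)))).interp = z ≫ snd X Y :=
  congrArg (z ≫ ·) (Category.id_comp (snd X Y))

section ImageUnion

variable {A B U Z Y : C}

theorem mem_imageFst (g : A ⟶ U) {z : Z ⟶ Pow S A ⊗ Pow S B} {a : Z ⟶ A}
    (h : (mem S A).Factors (lift a (z ≫ fst _ _))) :
    (mem S U).Factors (lift (a ≫ g) (z ≫ imageFst S B g)) :=
  mem_interp_image (Γ := .one (Pow S A ⊗ Pow S B)) g (interp_weaken_weaken_fst_var _ _ .last)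
    (comp_interp_fst_last (S := S) z ▸ h)

theorem eq_of_mem_imageFst {g : A ⟶ U} {z : Z ⟶ Pow S A ⊗ Pow S B} {u : Z ⟶ U}
    (hu : (mem S U).Factors (lift u (z ≫ imageFst S B g))) {x y : Z ⟶ Y}
    (h : ∀ (W : C) (k : W ⟶ Z) (a : W ⟶ A),
      (mem S A).Factors (lift a (k ≫ z ≫ fst _ _)) → k ≫ u = a ≫ g → k ≫ x = k ≫ y) :
    x = y :=
  eq_of_mem_interp_image (Γ := .one (Pow S A ⊗ Pow S B)) (interp_weaken_weaken_fst_var _ _ .last)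
    hu fun W k a ha e => h W k a (comp_interp_fst_last (S := S) z ▸ ha) e

theorem mem_imageSnd (g : B ⟶ U) {z : Z ⟶ Pow S A ⊗ Pow S B} {a : Z ⟶ B}
    (h : (mem S B).Factors (lift a (z ≫ snd _ _))) :
    (mem S U).Factors (lift (a ≫ g) (z ≫ imageSnd S A g)) :=
  mem_interp_image (Γ := .one (Pow S A ⊗ Pow S B)) g (interp_weaken_weaken_snd_var _ _ .last)
    (comp_interp_snd_last (S := S) z ▸ h)

theorem eq_of_mem_imageSnd {g : B ⟶ U} {z : Z ⟶ Pow S A ⊗ Pow S B} {u : Z ⟶ U}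
    (hu : (mem S U).Factors (lift u (z ≫ imageSnd S A g))) {x y : Z ⟶ Y}
    (h : ∀ (W : C) (k : W ⟶ Z) (a : W ⟶ B),
      (mem S B).Factors (lift a (k ≫ z ≫ snd _ _)) → k ≫ u = a ≫ g → k ≫ x = k ≫ y) :
    x = y :=
  eq_of_mem_interp_image (Γ := .one (Pow S A ⊗ Pow S B)) (interp_weaken_weaken_snd_var _ _ .last)
    hu fun W k a ha e => h W k a (comp_interp_snd_last (S := S) z ▸ ha) e

theorem mem_unionMap_left {z : Z ⟶ Pow S U ⊗ Pow S U} {u : Z ⟶ U}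
    (h : (mem S U).Factors (lift u (z ≫ fst _ _))) :
    (mem S U).Factors (lift u (z ≫ unionMap S U)) :=
  mem_interp_union_left (Γ := .one (Pow S U ⊗ Pow S U)) (interp_weaken_fst_var _ .last)
    (comp_interp_fst_last (S := S) z ▸ h)

theorem mem_unionMap_right {z : Z ⟶ Pow S U ⊗ Pow S U} {u : Z ⟶ U}
    (h : (mem S U).Factors (lift u (z ≫ snd _ _))) :
    (mem S U).Factors (lift u (z ≫ unionMap S U)) :=
  mem_interp_union_right (Γ := .one (Pow S U ⊗ Pow S U)) (interp_weaken_snd_var _ .last)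
    (comp_interp_snd_last (S := S) z ▸ h)

theorem eq_of_mem_unionMap {z : Z ⟶ Pow S U ⊗ Pow S U} {u : Z ⟶ U}
    (hu : (mem S U).Factors (lift u (z ≫ unionMap S U))) {x y : Z ⟶ Y}
    (hl : ∀ (W : C) (k : W ⟶ Z), (mem S U).Factors (lift (k ≫ u) (k ≫ z ≫ fst _ _)) →
      k ≫ x = k ≫ y)
    (hr : ∀ (W : C) (k : W ⟶ Z), (mem S U).Factors (lift (k ≫ u) (k ≫ z ≫ snd _ _)) →
      k ≫ x = k ≫ y) : x = y :=
  eq_of_mem_interp_union (Γ := .one (Pow S U ⊗ Pow S U)) (interp_weaken_fst_var _ .last)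
    (interp_weaken_snd_var _ .last) hu
    (fun W k h => hl W k (comp_interp_fst_last (S := S) z ▸ h))
    (fun W k h => hr W k (comp_interp_snd_last (S := S) z ▸ h))

variable (S) in
/-- The morphism `z ↦ g₀(fst z) ∪ g₁(snd z)`. -/
noncomputable def imageUnion (g₀ : A ⟶ U) (g₁ : B ⟶ U) : Pow S A ⊗ Pow S B ⟶ Pow S U :=
  lift (imageFst S B g₀) (imageSnd S A g₁) ≫ unionMap S U

variable {g₀ : A ⟶ U} {g₁ : B ⟶ U}

/-- By extensionality: a member of g₀({x}) ∪ g₁(∅) is g₀ of a member of {x}, or g₁ of a member of ∅,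
which is absurd; conversely x ∈ {x}. -/
theorem singLeft_imageUnion : singLeft S A B ≫ imageUnion S g₀ g₁ = g₀ ≫ singleton S U := by
  refine pow_ext fun W k u => ?_
  rw [← Category.assoc k g₀, mem_singleton_iff, imageUnion, ← Category.assoc, ← Category.assoc]
  constructor
  · intro h
    refine eq_of_mem_unionMap h (fun V l hl => ?_) (fun V l hr => ?_)
    · rw [Category.assoc, Category.assoc, lift_fst, ← Category.assoc, ← Category.assoc] at hl
      refine eq_of_mem_imageFst hl fun V' l' a ha e => ?_
      rw [Category.assoc, singLeft_fst, ← Category.assoc, mem_singleton_iff] at ha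
      rw [e, ha]
      simp only [Category.assoc]
    · rw [Category.assoc, Category.assoc, lift_snd, ← Category.assoc, ← Category.assoc] at hr
      refine eq_of_mem_imageSnd hr fun V' l' b hb e => ?_
      rw [Category.assoc, ← Category.assoc] at hb
      exact eq_of_mem_singLeft_snd hb _ _
  · rintro rfl
    refine mem_unionMap_left ?_
    rw [Category.assoc, lift_fst]
    refine mem_imageFst g₀ ?_
    rw [Category.assoc, singLeft_fst, mem_singleton_iff]

theorem singRight_imageUnion : singRight S A B ≫ imageUnion S g₀ g₁ = g₁ ≫ singleton S U := by
  refine pow_ext fun W k u => ?_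
  rw [← Category.assoc k g₁, mem_singleton_iff, imageUnion, ← Category.assoc, ← Category.assoc]
  constructor
  · intro h
    refine eq_of_mem_unionMap h (fun V l hl => ?_) (fun V l hr => ?_)
    · rw [Category.assoc, Category.assoc, lift_fst, ← Category.assoc, ← Category.assoc] at hl
      refine eq_of_mem_imageFst hl fun V' l' a ha e => ?_
      rw [Category.assoc, ← Category.assoc] at ha
      exact eq_of_mem_singRight_fst ha _ _
    · rw [Category.assoc, Category.assoc, lift_snd, ← Category.assoc, ← Category.assoc] at hr
      refine eq_of_mem_imageSnd hr fun V' l' b hb e => ?_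
      rw [Category.assoc, singRight_snd, ← Category.assoc, mem_singleton_iff] at hb
      rw [e, hb]
      simp only [Category.assoc]
  · rintro rfl
    refine mem_unionMap_right ?_
    rw [Category.assoc, lift_snd]
    refine mem_imageSnd g₁ ?_
    rw [Category.assoc, singRight_snd, mem_singleton_iff]

end ImageUnion

end Coproduct

-- Transport of the coproduct structure to Q, and the main theorem.

/-- A subobject `Q` of `X` that represents a monomorphism `[l, r] : A ⨿ B ⟶ X` is a coproduct of
`A` and `B`, with mediating morphisms computed by any `w : X ⟶ V` that extends them along `l`
and `r`. -/
theorem exists_coproduct_of_iso {C : Type u} [Category.{v} C] [HasBinaryCoproducts C]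
    {A B X : C} {Q : Subobject X} {l : A ⟶ X} {r : B ⟶ X} (q : A ⨿ B ≅ (Q : C))
    (hq : q.hom ≫ Q.arrow = coprod.desc l r) :
    ∃ (ιA : A ⟶ (Q : C)) (ιB : B ⟶ (Q : C)), ιA ≫ Q.arrow = l ∧ ιB ≫ Q.arrow = r ∧
      Nonempty (IsColimit (BinaryCofan.mk ιA ιB)) ∧
      ∀ (U V : C) (T : Subobject V) (g₀ : A ⟶ U) (g₁ : B ⟶ U) (s : U ⟶ V) (w : X ⟶ V)
        (e : U ≅ (T : C)), e.hom ≫ T.arrow = s → l ≫ w = g₀ ≫ s → r ≫ w = g₁ ≫ s →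
        ∃ m : (Q : C) ⟶ (T : C), m ≫ T.arrow = Q.arrow ≫ w ∧
          ιA ≫ m ≫ e.inv = g₀ ∧ ιB ≫ m ≫ e.inv = g₁ := by
  refine ⟨coprod.inl ≫ q.hom, coprod.inr ≫ q.hom, by simp [hq, coprod.inl_desc],
    by simp [hq, coprod.inr_desc],
    ⟨IsColimit.ofIsoColimit (coprodIsCoprod A B) (BinaryCofan.ext q rfl rfl)⟩, ?_⟩
  intro U V T g₀ g₁ s w e he hl hr
  -- The only possible m is the mediating morphism followed by e; its compatibility with w is
  -- checked on the two summands.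
  refine ⟨q.inv ≫ coprod.desc g₀ g₁ ≫ e.hom, ?_, by simp [coprod.inl_desc],
    by simp [coprod.inr_desc]⟩
  rw [← cancel_epi q.hom, ← Category.assoc q.hom Q.arrow, hq]
  apply coprod.hom_ext <;> simp [he, hl, hr]

end InternalLogic

theorem mainTheorem2 {C : Type u} [Category.{v} C] [CartesianMonoidalCategory C]
    [HasFiniteLimits C] [MonoidalClosed C] (S : Subobject.Classifier C) [HasCountableColimits C]
    (A B : C) :
    ∃ (ιA : A ⟶ ((InternalLogic.coprodFormula S A B).interp : C)) (ιB : B ⟶ ((InternalLogic.coprodFormula S A B).interp : C)),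
      ιA ≫ (InternalLogic.coprodFormula S A B).interp.arrow = (InternalLogic.singTerm S A).interp ≫ (InternalLogic.leftTerm S A B).interp ∧
      ιB ≫ (InternalLogic.coprodFormula S A B).interp.arrow = (InternalLogic.singTerm S B).interp ≫ (InternalLogic.rightTerm S A B).interp ∧
      Nonempty (IsColimit (BinaryCofan.mk ιA ιB)) ∧
      ∀ (U : C) (g₀ : A ⟶ U) (g₁ : B ⟶ U),
        ∃ (e : U ≅ ((InternalLogic.singFormula S U).interp : C))
          (m : ((InternalLogic.coprodFormula S A B).interp : C) ⟶ ((InternalLogic.singFormula S U).interp : C)),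
          e.hom ≫ (InternalLogic.singFormula S U).interp.arrow = (InternalLogic.singTerm S U).interp ∧
          m ≫ (InternalLogic.singFormula S U).interp.arrow =
            (InternalLogic.coprodFormula S A B).interp.arrow ≫ (InternalLogic.imageTerm S g₀ g₁).interp ≫
              (InternalLogic.unionTerm S U).interp ∧
          ιA ≫ m ≫ e.inv = g₀ ∧ ιB ≫ m ≫ e.inv = g₁ := by
  obtain ⟨q, hq⟩ := InternalLogic.exists_iso_coprodFormula (S := S) A B
  obtain ⟨ιA, ιB, hA, hB, hc, H⟩ :=
    InternalLogic.exists_coproduct_of_iso (X := InternalLogic.Pow S A ⊗ InternalLogic.Pow S B) q hq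
  refine ⟨ιA, ιB, hA.trans (InternalLogic.singTerm_comp_leftTerm S A B).symm,
    hB.trans (InternalLogic.singTerm_comp_rightTerm S A B).symm, hc, fun U g₀ g₁ => ?_⟩
  obtain ⟨e, he⟩ := InternalLogic.exists_iso_singFormula (S := S) U
  obtain ⟨m, hm, h₀, h₁⟩ := H U (InternalLogic.Pow S U) _ g₀ g₁ _
    (InternalLogic.imageUnion S g₀ g₁) e he InternalLogic.singLeft_imageUnion
    InternalLogic.singRight_imageUnion
  -- `singleton` and `imageUnion` agree definitionally with the interpreted terms of the statement.
  exact ⟨e, m, he, hm, h₀, h₁⟩
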